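/- Let $P,Q$ be complex polynomials, not identically zero, with $\deg Q-\deg P=-1$, let $T=Q(z)\frac{d}{dz}+P(z)$ and $R=Q/P$, and let $\lambda$ be the quotient of the leading coefficients of $Q$ and $P$. Call a closed set $S\subset\mathbb{C}$ *continuously Hutchinson invariant* if, for every $u\in S$ and every real $t\ge 0$, the function $T\big((z-u)^t\big)$ either has all its roots in $S$ or vanishes identically. Let $M$ be the minimal nonempty continuously Hutchinson invariant set (the intersection of all nonempty ones), and let $\mathrm{Conv}(M)$ be its closed convex hull. Let $\mathcal{Z}(PQ)$ be the set of roots of $P$ and $Q$, and let the horizontal locus $\mathcal{H}_R$ be the closure of the set of $z\notin\mathcal{Z}(PQ)$ such that $\arg R(z)=\frac{\arg\lambda+\pi}{2}$ or $\arg R(z)=\frac{\arg\lambda-\pi}{2}$ modulo $2\pi$. A strip is a closed region bounded by two parallel lines, where the two lines may coincide (so that the strip is a line). Then $\mathrm{Conv}(M)$ is the smallest nonempty convex continuously Hutchinson invariant set, and it is a strip, of positive width if $M$ has nonempty interior. More precisely, $\mathrm{Conv}(M)$ is the smallest (with respect to inclusion) strip containing $\mathcal{H}_R\cup\mathcal{Z}(PQ)$.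 -/

import Mathlib

open Polynomial Topology

noncomputable section

/-- The operator `T = Q d/dz + P` applied to a (locally defined) function `f`, at the point `z`. -/
def diffOp (P Q : ℂ[X]) (f : ℂ → ℂ) (z : ℂ) : ℂ :=
  Q.eval z * deriv f z + P.eval z * f z

/-- `f` is, near `z`, a holomorphic branch of the multivalued function `w ↦ (w - u) ^ t`, that is,
`exp (t * L)` for a local holomorphic logarithm `L` of `w - u` (this forces `z ≠ u`). -/
def IsPowerBranchAt (u : ℂ) (t : ℝ) (f : ℂ → ℂ) (z : ℂ) : Prop :=
  ∃ L : ℂ → ℂ, AnalyticAt ℂ L z ∧ (∀ᶠ w in 𝓝 z, Complex.exp (L w) = w - u) ∧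
    f =ᶠ[𝓝 z] fun w => Complex.exp ((t : ℂ) * L w)

/-- `z` is a root of `T((w - u) ^ t)`, away from the branch point `u`. -/
def IsImageRoot (P Q : ℂ[X]) (u : ℂ) (t : ℝ) (z : ℂ) : Prop :=
  ∃ f : ℂ → ℂ, IsPowerBranchAt u t f z ∧ diffOp P Q f z = 0

/-- Continuously Hutchinson invariant sets of `T = Q d/dz + P`: closed sets `S` such that, for all
`u ∈ S` and all real `t ≥ 0`, the function `T((z - u) ^ t)` has all its roots in `S` or vanishes
identically. (A root at the branch point `u` lies in `S` anyway.) -/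
def IsCHInvariant (P Q : ℂ[X]) (S : Set ℂ) : Prop :=
  IsClosed S ∧ ∀ u ∈ S, ∀ t : ℝ, 0 ≤ t →
    ((∀ z, IsImageRoot P Q u t z → z ∈ S) ∨ (∀ z, z ≠ u → IsImageRoot P Q u t z))

/-- The minimal continuously Hutchinson invariant set: the intersection of all nonempty ones. -/
def minimalCHSet (P Q : ℂ[X]) : Set ℂ :=
  ⋂₀ {S : Set ℂ | S.Nonempty ∧ IsCHInvariant P Q S}

/-- The roots of `P` and `Q`. -/
def rootLocus (P Q : ℂ[X]) : Set ℂ := {z | P.eval z = 0 ∨ Q.eval z = 0}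

/-- `λ`, the quotient of the leading coefficients of `Q` and `P`. -/
def leadRatio (P Q : ℂ[X]) : ℂ := Q.leadingCoeff / P.leadingCoeff

/-- The argument of `R(z) = Q(z) / P(z)`, as a point of the circle `ℝ / 2πℤ`. -/
def fieldDirection (P Q : ℂ[X]) (z : ℂ) : Real.Angle :=
  ((Q.eval z / P.eval z).arg : Real.Angle)

/-- The horizontal locus: the closure of the set of points `z`, not roots of `P` or `Q`, at which
the argument of `R` is `(arg λ + π) / 2` or `(arg λ - π) / 2`. -/
def horizontalLocus (P Q : ℂ[X]) : Set ℂ :=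
  closure {z : ℂ | z ∉ rootLocus P Q ∧
    (fieldDirection P Q z = ((((leadRatio P Q).arg + Real.pi) / 2 : ℝ) : Real.Angle) ∨
     fieldDirection P Q z = ((((leadRatio P Q).arg - Real.pi) / 2 : ℝ) : Real.Angle))}

/-- The closed region between two lines parallel to the direction `v` (a line when `a = b`). -/
def closedStrip (v : ℂ) (a b : ℝ) : Set ℂ := {z | a ≤ (z / v).im ∧ (z / v).im ≤ b}

/-- Bi-infinite closed strips; the degenerate case of a line is allowed. -/
def IsStrip (K : Set ℂ) : Prop :=
  ∃ (v : ℂ) (a b : ℝ), v ≠ 0 ∧ a ≤ b ∧ K = closedStrip v a b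

/-- Bi-infinite closed strips of positive width. -/
def IsProperStrip (K : Set ℂ) : Prop :=
  ∃ (v : ℂ) (a b : ℝ), v ≠ 0 ∧ a < b ∧ K = closedStrip v a b

/-- The closed convex hull of the minimal set. -/
def convMinimalCHSet (P Q : ℂ[X]) : Set ℂ := closure (convexHull ℝ (minimalCHSet P Q))

end

open Polynomial Topology

noncomputable section

open Filter Bornology Set

/-! Since `T((z - u)^t) = (z - u)^(t-1) (tQ + (z - u)P)`, a point `z` with `P z ≠ 0` and `z ≠ u` is
a root exactly when `u = z + t R(z)`. Invariance therefore means: `S` contains the roots of `P` and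
`Q`, and every other point whose forward ray along `R` meets `S` (`isCHInvariant_iff`).

At infinity `R(z) ~ λ/z`. Rotating and scaling by `v` with `v² = -λ` turns this into `-1/z`, and the
horizontal locus into the closure of the points where the field is real. Let `N` be the set of roots
in these coordinates.

The field points up far above and down far below, so `N` and the horizontal points have bounded
height. Outside the strip between their extreme heights the field keeps pointing away, so the strip
is invariant (`isRayInvariant_strip`) and contains the hull of `M`.

For the converse, an invariant set is unbounded to the right and left, so only horizontal lines can
bound it. It remains to see that a height bound for `S` also bounds the horizontal points
(`im_le_of_mem_horizontalSet`). Suppose `z` is horizontal, above `S`, with `R(z) > 0`. By the open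
mapping property some nearby `w` has a slightly descending ray. For fixed `u ∈ S`, `(u - w)/R(w)`
behaves like `w²` far to the right, so the descending ray must cross a point whose own ray reaches
`u`. That point is in `S`, hence so is the nearby `w`, although it lies above `S`. Hahn-Banach then
yields the hull (`mem_closure_convexHull`).

Finally, horizontal points go off to infinity at bounded height, so every competing strip is
horizontal (`mem_closedStrip`). -/

/-- Closed sets `S` containing `N` such that every point off `N` whose forward ray in the direction
of `R` meets `S` belongs to `S`. -/
def IsRayInvariant (N : Set ℂ) (R : ℂ → ℂ) (S : Set ℂ) : Prop :=
  IsClosed S ∧ N ⊆ S ∧ ∀ z, z ∉ N → ∀ t : ℝ, 0 ≤ t → z + t * R z ∈ S → z ∈ S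

/-- A direction field `R`, nonvanishing off the nonempty set `N`, behaving like `-1 / (z - c)` at
infinity and satisfying the open mapping property. -/
structure IsNormalizedField (N : Set ℂ) (R : ℂ → ℂ) : Prop where
  nonempty : N.Nonempty
  isBounded : IsBounded N
  continuousAt : ∀ z, z ∉ N → ContinuousAt R z
  ne_zero : ∀ z, z ∉ N → R z ≠ 0
  tendsto : ∃ c, Tendsto (fun z => (R z)⁻¹ + z) (cobounded ℂ) (𝓝 c)
  nhds_le_map : ∀ z, z ∉ N → 𝓝 (R z) ≤ map R (𝓝 z)

/-- Points off `N` where the field is horizontal. -/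
def horizontalSet (N : Set ℂ) (R : ℂ → ℂ) : Set ℂ := {z | z ∉ N ∧ (R z).im = 0}

theorem pos_of_isPreconnected {s : Set ℂ} (hs : IsPreconnected s) {f : ℂ → ℝ}
    (hf : ContinuousOn f s) (hne : ∀ x ∈ s, f x ≠ 0) {x : ℂ} (hx : x ∈ s) (hpos : 0 < f x) :
    ∀ y ∈ s, 0 < f y := by
  intro y hy
  by_contra h
  obtain ⟨w, hw, hw0⟩ := hs.intermediate_value hy hx hf ⟨not_lt.mp h, hpos.le⟩
  exact hne w hw hw0

theorem IsRayInvariant.preimage {N : Set ℂ} {R : ℂ → ℂ} {S : Set ℂ} (φ : ℂ ≃L[ℝ] ℂ)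
    (h : IsRayInvariant N R S) :
    IsRayInvariant (φ ⁻¹' N) (fun z => φ.symm (R (φ z))) (φ ⁻¹' S) := by
  refine ⟨h.1.preimage φ.continuous, preimage_mono h.2.1, fun z hz t ht hS => ?_⟩
  refine h.2.2 (φ z) hz t ht ?_
  have : φ (z + t * φ.symm (R (φ z))) = φ z + t * R (φ z) := by
    rw [map_add, ← Complex.real_smul, map_smul, φ.apply_symm_apply, Complex.real_smul]
  rwa [mem_preimage, this] at hS

theorem isRayInvariant_sInter {N : Set ℂ} {R : ℂ → ℂ} {A : Set (Set ℂ)}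
    (h : ∀ S ∈ A, IsRayInvariant N R S) : IsRayInvariant N R (⋂₀ A) :=
  ⟨isClosed_sInter fun S hS => (h S hS).1, subset_sInter fun S hS => (h S hS).2.1,
    fun z hz t ht hm => mem_sInter.mpr fun S hS =>
      (h S hS).2.2 z hz t ht (mem_sInter.mp hm S hS)⟩

/-! ### Symmetries and behaviour at infinity of a normalized field. -/

namespace IsNormalizedField

variable {N : Set ℂ} {R : ℂ → ℂ} {S : Set ℂ}

/-- Commuting with inversion is what preserves the form `-1/(z - c)` at infinity. Conjugation and
the half turn qualify, which reduces four directional cases to one. -/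
theorem symmetry (h : IsNormalizedField N R) (φ : ℂ ≃ₗᵢ[ℝ] ℂ) (hφ : ∀ z, φ.symm z⁻¹ = (φ.symm z)⁻¹) :
    IsNormalizedField (φ ⁻¹' N) (fun z => φ.symm (R (φ z))) where
  nonempty := h.nonempty.preimage φ.surjective
  isBounded := φ.antilipschitz.isBounded_preimage h.isBounded
  continuousAt z hz := φ.symm.continuous.continuousAt.comp
    ((h.continuousAt (φ z) hz).comp φ.continuous.continuousAt)
  ne_zero z hz := by simpa using h.ne_zero (φ z) hz
  tendsto := by
    obtain ⟨c, hc⟩ := h.tendsto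
    refine ⟨φ.symm c, ?_⟩
    have h2 := (φ.symm.continuous.tendsto c).comp
      (hc.comp φ.antilipschitz.tendsto_cobounded)
    refine h2.congr fun z => ?_
    simp [hφ]
  nhds_le_map z hz := by
    have h1 := h.nhds_le_map (φ z) hz
    have e1 : map φ (𝓝 z) = 𝓝 (φ z) := φ.toHomeomorph.map_nhds_eq z
    have e2 : map φ.symm (𝓝 (R (φ z))) = 𝓝 (φ.symm (R (φ z))) :=
      φ.symm.toHomeomorph.map_nhds_eq _
    rw [← e2]
    refine (map_mono h1).trans ?_
    rw [← e1, Filter.map_map, Filter.map_map]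
    exact le_rfl

theorem continuousOn (h : IsNormalizedField N R) : ContinuousOn R Nᶜ :=
  fun z hz => (h.continuousAt z hz).continuousWithinAt

theorem exists_far (h : IsNormalizedField N R) : ∃ c, ∀ ε > 0, ∃ ρ > 0, ∀ z : ℂ, ρ ≤ ‖z‖ →
    z ∉ N ∧ ‖(R z)⁻¹ + z - c‖ < ε := by
  obtain ⟨c, hc⟩ := h.tendsto
  refine ⟨c, fun ε hε => ?_⟩
  have h1 := (Metric.tendsto_nhds.mp hc ε hε).and (isBounded_def.mp h.isBounded)
  obtain ⟨ρ, -, hρ⟩ := (hasBasis_cobounded_norm (E := ℂ)).eventually_iff.mp h1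
  refine ⟨max ρ 1, by positivity, fun z hz => ?_⟩
  have := hρ (show ρ ≤ ‖z‖ from (le_max_left _ _).trans hz)
  exact ⟨this.2, by simpa [dist_eq_norm] using this.1⟩

theorem inv_im_neg {z : ℂ} (hz : (z⁻¹).im < 0) : 0 < z.im := by
  rw [Complex.inv_im] at hz
  by_contra! hc
  have : 0 ≤ -z.im / Complex.normSq z := div_nonneg (by linarith) (Complex.normSq_nonneg z)
  linarith

theorem inv_im_eq_zero {z : ℂ} (hz : (z⁻¹).im = 0) : z.im = 0 := by
  rw [Complex.inv_im, div_eq_zero_iff, Complex.normSq_eq_zero] at hz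
  rcases hz with hz | hz
  · linarith
  · simp [hz]

/-- The field points upwards far above the real axis. -/
theorem exists_im_pos (h : IsNormalizedField N R) :
    ∃ Y, ∀ z : ℂ, Y < z.im → z ∉ N ∧ 0 < (R z).im := by
  obtain ⟨c, hc⟩ := h.exists_far
  obtain ⟨ρ, hρ, hfar⟩ := hc 1 one_pos
  refine ⟨max ρ (c.im + 1), fun z hz => ?_⟩
  have hz1 := (le_max_left _ _).trans_lt hz
  have hz2 := (le_max_right _ _).trans_lt hz
  obtain ⟨hN, hb⟩ := hfar z (hz1.le.trans ((le_abs_self _).trans (Complex.abs_im_le_norm z)))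
  refine ⟨hN, inv_im_neg ?_⟩
  have := (abs_lt.mp ((Complex.abs_im_le_norm _).trans_lt hb)).2
  simp only [Complex.sub_im, Complex.add_im] at this
  linarith

/-- Above a bound for the horizontal points, the field points upwards. -/
theorem im_pos_above (h : IsNormalizedField N R) {b : ℝ}
    (hb : ∀ z ∈ N ∪ horizontalSet N R, z.im ≤ b) {z : ℂ} (hz : b < z.im) : 0 < (R z).im := by
  obtain ⟨Y, hY⟩ := h.exists_im_pos
  have hN : ∀ w ∈ {w : ℂ | b < w.im}, w ∉ N := fun w hw hwN =>
    absurd (hb w (Or.inl hwN)) (not_le.mpr hw)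
  -- The half plane is connected and contains no horizontal point, so the sign found far up holds
  -- throughout.
  refine pos_of_isPreconnected (s := {w : ℂ | b < w.im}) (convex_halfSpace_im_gt b).isPreconnected
    (f := fun w => (R w).im)
    (Complex.continuous_im.comp_continuousOn (h.continuousOn.mono hN)) (fun w hw h0 => ?_)
    (x := ⟨0, max b Y + 1⟩) ?_ (hY _ ?_).2 z hz
  · exact absurd (hb w (Or.inr ⟨hN w hw, h0⟩)) (not_le.mpr hw)
  · show b < max b Y + 1
    linarith [le_max_left b Y]
  · show Y < max b Y + 1
    linarith [le_max_right b Y]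

/-- Horizontal points exist arbitrarily far to the right. -/
theorem exists_horizontal_re_ge (h : IsNormalizedField N R) (X : ℝ) :
    ∃ z ∈ horizontalSet N R, X ≤ z.re := by
  obtain ⟨c, hc⟩ := h.exists_far
  obtain ⟨ρ, hρ, hfar⟩ := hc 1 one_pos
  set x := max X ρ
  have hnorm : ∀ y : ℝ, ρ ≤ ‖(⟨x, y⟩ : ℂ)‖ := fun y =>
    (le_max_right X ρ).trans ((le_abs_self x).trans (Complex.abs_re_le_norm ⟨x, y⟩))
  -- On the line `Re = x`, `Im (1/R)` is within 1 of `c.im - y`, so it changes sign between `c.im -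
  -- 1` and `c.im + 1`.
  have hcont : Continuous fun y : ℝ => ((R ⟨x, y⟩)⁻¹).im := by
    refine Complex.continuous_im.comp ?_
    rw [continuous_iff_continuousAt]
    intro y
    have hN := (hfar _ (hnorm y)).1
    have hline : Continuous fun y : ℝ => (⟨x, y⟩ : ℂ) := by
      have : (fun y : ℝ => (⟨x, y⟩ : ℂ)) = fun y : ℝ => (x : ℂ) + y * Complex.I := by
        funext y; apply Complex.ext <;> simp
      rw [this]; fun_prop
    exact (ContinuousAt.comp (f := fun y : ℝ => (⟨x, y⟩ : ℂ)) (h.continuousAt _ hN)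
      hline.continuousAt).inv₀ (h.ne_zero _ hN)
  have him : ∀ y : ℝ, |((R ⟨x, y⟩)⁻¹).im + y - c.im| < 1 := fun y => by
    simpa using (Complex.abs_im_le_norm _).trans_lt (hfar _ (hnorm y)).2
  obtain ⟨y, -, hy⟩ := intermediate_value_Icc' (by linarith : c.im - 1 ≤ c.im + 1)
    hcont.continuousOn (show (0 : ℝ) ∈ Icc _ _ from
      ⟨by linarith [(abs_lt.mp (him (c.im + 1))).2], by linarith [(abs_lt.mp (him (c.im - 1))).1]⟩)
  exact ⟨⟨x, y⟩, ⟨(hfar _ (hnorm y)).1, inv_im_eq_zero hy⟩, le_max_left X ρ⟩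

/-! ### Invariant sets far to the right. -/

/-- A point belongs to an invariant set as soon as its ray passes through some `u ∈ S`. -/
theorem mem_of_div_eq (h : IsNormalizedField N R) (hS : IsRayInvariant N R S) {u w : ℂ}
    (hu : u ∈ S) (hw : w ∉ N) (him : ((u - w) / R w).im = 0) (hre : 0 ≤ ((u - w) / R w).re) :
    w ∈ S := by
  refine hS.2.2 w hw _ hre ?_
  have h1 : ((((u - w) / R w).re : ℝ) : ℂ) = (u - w) / R w := by
    apply Complex.ext <;> simp [him]
  rw [h1, div_mul_cancel₀ _ (h.ne_zero w hw)]
  simpa using hu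

/-- With `1/R(w) = -w + c + e` and `‖e‖ < 1`, the difference from `w²` is only linear in `‖w‖`, with
constant `K`. -/
theorem exists_div_sub_sq_le (h : IsNormalizedField N R) (u : ℂ) {ε : ℝ} (hε : 0 < ε) :
    ∃ ρ > 0, ∀ w : ℂ, ρ ≤ ‖w‖ → w ∉ N ∧ ‖(u - w) / R w - w ^ 2‖ ≤ ε * ‖w‖ ^ 2 := by
  obtain ⟨c, hc⟩ := h.exists_far
  obtain ⟨ρ, hρ, hfar⟩ := hc 1 one_pos
  set K := ‖u‖ + 2 * (‖c‖ + 1)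
  have hK : 0 < K := by positivity
  refine ⟨max ρ (max ‖u‖ (K / ε)), lt_max_of_lt_left hρ, fun w hw => ?_⟩
  simp only [max_le_iff] at hw
  obtain ⟨hw1, hw2, hw3⟩ := hw
  obtain ⟨hN, he⟩ := hfar w hw1
  refine ⟨hN, ?_⟩
  set e := (R w)⁻¹ + w - c with he_def
  have h1 : (u - w) / R w - w ^ 2 = -(u * w) + (u - w) * (c + e) := by
    rw [he_def, div_eq_mul_inv]; ring
  rw [div_le_iff₀ hε] at hw3
  rw [h1]
  calc ‖-(u * w) + (u - w) * (c + e)‖ ≤ ‖u‖ * ‖w‖ + (‖u‖ + ‖w‖) * (‖c‖ + ‖e‖) := by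
        refine (norm_add_le _ _).trans ?_
        rw [norm_neg, norm_mul, norm_mul]
        gcongr
        · exact norm_sub_le _ _
        · exact norm_add_le _ _
    _ ≤ ‖u‖ * ‖w‖ + (‖w‖ + ‖w‖) * (‖c‖ + 1) := by gcongr
    _ = K * ‖w‖ := by ring
    _ ≤ (‖w‖ * ε) * ‖w‖ := by gcongr
    _ = ε * ‖w‖ ^ 2 := by ring

/-- In a horizontal cone far to the right, `(u - w) / R w` is close to `w ^ 2`. -/
theorem exists_cone_bounds (h : IsNormalizedField N R) (u : ℂ) {ε : ℝ} (hε : 0 < ε) :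
    ∃ ρ > 0, ∀ w : ℂ, ρ ≤ w.re → |w.im| ≤ w.re / 2 → w ∉ N ∧
      |((u - w) / R w).re - (w.re ^ 2 - w.im ^ 2)| ≤ ε * w.re ^ 2 ∧
      |((u - w) / R w).im - 2 * (w.re * w.im)| ≤ ε * w.re ^ 2 := by
  obtain ⟨ρ, hρ, hfar⟩ := h.exists_div_sub_sq_le u (ε := ε / 2) (by positivity)
  refine ⟨ρ, hρ, fun w hw hcone => ?_⟩
  obtain ⟨hN, hb⟩ := hfar w (hw.trans ((le_abs_self _).trans (Complex.abs_re_le_norm w)))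
  -- This factor 2 is the reason for asking for `ε / 2` above.
  have hsq : ‖w‖ ^ 2 ≤ 2 * w.re ^ 2 := by
    rw [Complex.sq_norm, Complex.normSq_apply]
    have := sq_le_sq' (by linarith [abs_nonneg w.im, hρ.trans_le hw]) hcone
    rw [sq_abs] at this
    nlinarith [sq_nonneg w.re]
  have hb' : ‖(u - w) / R w - w ^ 2‖ ≤ ε * w.re ^ 2 := by nlinarith
  have e1 := (Complex.abs_re_le_norm _).trans hb'
  have e2 := (Complex.abs_im_le_norm _).trans hb'
  rw [Complex.sub_re] at e1
  rw [Complex.sub_im] at e2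
  have r1 : (w ^ 2).re = w.re ^ 2 - w.im ^ 2 := by rw [sq, Complex.mul_re]; ring
  have r2 : (w ^ 2).im = 2 * (w.re * w.im) := by rw [sq, Complex.mul_im]; ring
  exact ⟨hN, r1 ▸ e1, r2 ▸ e2⟩

theorem continuousAt_div (h : IsNormalizedField N R) (u : ℂ) {w : ℂ} (hw : w ∉ N) :
    ContinuousAt (fun w => (u - w) / R w) w :=
  (by fun_prop : ContinuousAt (fun w => u - w) w).div (h.continuousAt w hw) (h.ne_zero w hw)

/-- Invariant sets are unbounded to the right. -/
theorem exists_mem_re_ge (h : IsNormalizedField N R) (hS : IsRayInvariant N R S) (X : ℝ) :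
    ∃ w ∈ S, X ≤ w.re := by
  obtain ⟨u, hu⟩ := h.nonempty
  obtain ⟨ρ, hρ, hcone⟩ := h.exists_cone_bounds u (ε := 1 / 4) (by norm_num)
  -- On the segment `Re w = x`, `|Im w| ≤ x/4`, closeness to `w²` makes the imaginary part change
  -- sign while the real part stays positive.
  set x := max X ρ
  have hx : 0 < x := lt_max_of_lt_right hρ
  have hb : ∀ y ∈ Icc (-(x / 4)) (x / 4), _ := fun y hy => hcone ⟨x, y⟩ (le_max_right X ρ)
    (by rw [abs_le]; constructor <;> simp only <;> linarith [hy.1, hy.2])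
  have hline : Continuous fun y : ℝ => (⟨x, y⟩ : ℂ) := by
    have : (fun y : ℝ => (⟨x, y⟩ : ℂ)) = fun y : ℝ => (x : ℂ) + y * Complex.I := by
      funext y; apply Complex.ext <;> simp
    rw [this]; fun_prop
  have hcont : ContinuousOn (fun y : ℝ => ((u - ⟨x, y⟩) / R ⟨x, y⟩).im) (Icc (-(x / 4)) (x / 4)) := by
    intro y hy
    refine (Complex.continuous_im.continuousAt.comp ?_).continuousWithinAt
    exact ContinuousAt.comp (f := fun y : ℝ => (⟨x, y⟩ : ℂ)) (g := fun w => (u - w) / R w)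
      (h.continuousAt_div u (hb y hy).1) hline.continuousAt
  have hlo := (abs_le.mp (hb (-(x / 4)) ⟨le_rfl, by linarith⟩).2.2).2
  have hhi := (abs_le.mp (hb (x / 4) ⟨by linarith, le_rfl⟩).2.2).1
  simp only at hlo hhi
  obtain ⟨y, hy, hy0⟩ := intermediate_value_Icc (by linarith : -(x / 4) ≤ x / 4) hcont
    (show (0 : ℝ) ∈ Icc _ _ from ⟨by nlinarith, by nlinarith⟩)
  obtain ⟨hN, hre, -⟩ := hb y hy
  refine ⟨⟨x, y⟩, h.mem_of_div_eq hS (hS.2.1 hu) hN hy0 ?_, le_max_left X ρ⟩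
  have := (abs_le.mp hre).1
  simp only at this
  nlinarith [hy.1, hy.2, mul_nonneg (sub_nonneg.mpr hy.1) (sub_nonneg.mpr hy.2)]

/-! ### Height bounds of an invariant set bound the horizontal points. -/

/-- To the right and above an invariant set, `(u - w) / R w` lies in the upper half plane. -/
theorem exists_div_im_pos (h : IsNormalizedField N R) (hS : IsRayInvariant N R S) {β : ℝ}
    (hβ : ∀ w ∈ S, w.im ≤ β) {u : ℂ} (hu : u ∈ S) : ∃ ρ, ∀ w : ℂ, ρ < w.re → β < w.im →
      w.im < w.re / 2 → 0 < ((u - w) / R w).im := by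
  obtain ⟨ρ, hρ, hcone⟩ := h.exists_cone_bounds u (ε := 1 / 4) (by norm_num)
  set σ := max ρ (2 * |β|)
  set D : Set ℂ := {w | σ < w.re} ∩ ({w | β < w.im} ∩ {w | w.im < w.re / 2})
  have hD : Convex ℝ D := by
    refine (convex_halfSpace_re_gt σ).inter ((convex_halfSpace_im_gt β).inter ?_)
    intro x hx y hy a b ha hb hab
    simp only [mem_ofPred_eq, Complex.add_re, Complex.add_im, Complex.real_smul, Complex.re_ofReal_mul,
      Complex.im_ofReal_mul] at hx hy ⊢
    rcases ha.eq_or_lt with rfl | ha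
    · have : b = 1 := by linarith
      subst this; linarith
    · nlinarith [mul_lt_mul_of_pos_left hx ha, mul_le_mul_of_nonneg_left hy.le hb]
  have hbd : ∀ w ∈ D, ρ ≤ w.re ∧ |w.im| ≤ w.re / 2 := by
    rintro w ⟨h1, h2, h3⟩
    simp only [mem_ofPred_eq] at h1 h2 h3
    have := le_max_left ρ (2 * |β|)
    have := le_max_right ρ (2 * |β|)
    refine ⟨by linarith, abs_le.mpr ⟨?_, h3.le⟩⟩
    linarith [neg_abs_le β]
  have hN : ∀ w ∈ D, w ∉ N := fun w hw => (hcone w (hbd w hw).1 (hbd w hw).2).1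
  refine ⟨σ, fun w h1 h2 h3 => ?_⟩
  -- At the test point `(x, x/4)` the main term `2 · x · x/4` beats the error `x²/4`.
  set x := 4 * (σ + |β|) + 1
  have hσ : 0 < σ := lt_max_of_lt_left hρ
  have hx : (⟨x, x / 4⟩ : ℂ) ∈ D := by
    have := abs_nonneg β
    have := le_abs_self β
    refine ⟨?_, ?_, ?_⟩ <;> simp only [mem_ofPred_eq] <;> linarith
  refine pos_of_isPreconnected hD.isPreconnected (f := fun w => ((u - w) / R w).im)
    (fun w hw => (Complex.continuous_im.continuousAt.comp
      (h.continuousAt_div u (hN w hw))).continuousWithinAt) (fun w hw h0 => ?_) hx ?_ w ⟨h1, h2, h3⟩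
  -- At a zero of the imaginary part the real part is nonnegative, so the point would be in `S`,
  -- above the height `β`.
  · obtain ⟨hw1, hw2⟩ := hbd w hw
    have hre := (abs_le.mp (hcone w hw1 hw2).2.1).1
    have hsq := sq_le_sq' (by linarith [abs_nonneg w.im]) hw2
    rw [sq_abs] at hsq
    exact absurd (hβ w (h.mem_of_div_eq hS hu (hN w hw) h0 (by nlinarith [sq_nonneg w.re])))
      (not_le.mpr hw.2.1)
  · have hxp : 0 < x := by positivity
    have := (abs_le.mp (hcone _ (hbd _ hx).1 (hbd _ hx).2).2.2).1
    simp only at this ⊢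
    nlinarith

/-- The open mapping property produces descending directions arbitrarily close to a horizontal
point, even where the field is critical. -/
theorem frequently_im_neg (h : IsNormalizedField N R) {z : ℂ} (hz : z ∈ horizontalSet N R) :
    ∃ᶠ w in 𝓝 z, (R w).im < 0 := by
  have h1 : ∃ᶠ y in 𝓝 (R z), y.im < 0 := by
    have : R z ∈ closure {y : ℂ | y.im < 0} := by
      rw [Complex.closure_setOfPred_im_lt]
      exact hz.2.le
    exact mem_closure_iff_frequently.mp this
  exact frequently_map.mp (h1.filter_mono (h.nhds_le_map z hz.1))

/-- Rays sloping slightly downwards to the right from above an invariant set hit that set. -/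
theorem not_ray_downwards (h : IsNormalizedField N R) (hS : IsRayInvariant N R S) {β : ℝ}
    (hβ : ∀ w ∈ S, w.im ≤ β) {u : ℂ} (hu : u ∈ S) :
    ∃ ρ, ∀ z : ℂ, β < z.im → (R z).im < 0 → -(R z).im ≤ (R z).re / 2 → ∀ s₁ : ℝ, 0 ≤ s₁ →
      ρ < (z + s₁ * R z).re → β < (z + s₁ * R z).im →
      (z + s₁ * R z).im < (z + s₁ * R z).re / 2 → False := by
  obtain ⟨ρ₁, hpos⟩ := h.exists_div_im_pos hS hβ hu
  obtain ⟨ρ₂, hρ₂, hcone⟩ := h.exists_cone_bounds u (ε := 1 / 4) (by norm_num)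
  refine ⟨max ρ₁ (max ρ₂ (2 * |β|)), fun z hz hneg hslope s₁ hs₁ hw1 hw2 hw3 => ?_⟩
  have hw1' := (le_max_left _ _).trans_lt hw1
  have hw1'' := (le_max_right _ _).trans_lt hw1
  have hzS : z ∉ S := fun hm => absurd (hβ z hm) (not_le.mpr hz)
  have hzN : z ∉ N := fun hm => hzS (hS.2.1 hm)
  have hstart := hpos _ hw1' hw2 hw3
  set A := (R z).re with hA
  set B := (R z).im with hB
  have hApos : 0 < A := by linarith
  have hre : ∀ s : ℝ, (z + s * R z).re = z.re + s * A := fun s => by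
    rw [Complex.add_re, Complex.re_ofReal_mul]
  have him : ∀ s : ℝ, (z + s * R z).im = z.im + s * B := fun s => by
    rw [Complex.add_im, Complex.im_ofReal_mul]
  rw [hre, him] at hw3
  rw [him] at hw2
  rw [hre] at hw1''
  have hb1 := (le_max_left _ _).trans_lt hw1''
  have hb2 := (le_max_right _ _).trans_lt hw1''
  have hin : ∀ s : ℝ, s₁ ≤ s → ρ₂ ≤ (z + s * R z).re ∧ |(z + s * R z).im| ≤ (z + s * R z).re / 2 := by
    intro s hs
    rw [hre, him, abs_le]
    have hsA : s₁ * A ≤ s * A := by gcongr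
    have hsB : (s - s₁) * (-B) ≤ (s - s₁) * (A / 2) :=
      mul_le_mul_of_nonneg_left hslope (by linarith)
    have hsB' : 0 ≤ (s - s₁) * (-B) := mul_nonneg (by linarith) (by linarith)
    have := neg_abs_le β
    refine ⟨by linarith, by nlinarith, by nlinarith⟩
  -- Half the descending slope: the ray eventually stays below the line `y = -κ x`, and `s₂` is a
  -- parameter at which this has happened.
  set κ := -B / (2 * A) with hκ
  have hκpos : 0 < κ := by apply div_pos <;> linarith
  have hκA : κ * A = -B / 2 := by rw [hκ]; field_simp
  obtain ⟨ρ₃, hρ₃, hcone'⟩ := h.exists_cone_bounds u hκpos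
  set s₂ := max s₁ (max ((ρ₃ - z.re) / A) ((z.im + κ * z.re) / (-B / 2)))
  have hs12 : s₁ ≤ s₂ := le_max_left _ _
  have hs2a : (ρ₃ - z.re) / A ≤ s₂ := (le_max_left _ _).trans (le_max_right _ _)
  have hs2b : (z.im + κ * z.re) / (-B / 2) ≤ s₂ := (le_max_right _ _).trans (le_max_right _ _)
  rw [div_le_iff₀ hApos] at hs2a
  rw [div_le_iff₀ (by linarith)] at hs2b
  -- There `2xy ≤ -2κx²`, while the error is at most `κx²`.
  have hend : ((u - (z + s₂ * R z)) / R (z + s₂ * R z)).im < 0 := by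
    have hx : ρ₃ ≤ (z + s₂ * R z).re := by rw [hre]; linarith
    have hy : (z + s₂ * R z).im ≤ -κ * (z + s₂ * R z).re := by
      rw [hre, him]
      nlinarith
    have := (abs_le.mp (hcone' _ hx (hin s₂ hs12).2).2.2).2
    have hxpos : 0 < (z + s₂ * R z).re := by linarith
    nlinarith [mul_le_mul_of_nonneg_left hy hxpos.le, mul_pos hκpos (mul_pos hxpos hxpos)]
  have hcont : ContinuousOn (fun s : ℝ => ((u - (z + s * R z)) / R (z + s * R z)).im) (Icc s₁ s₂) := by
    intro s hs
    refine (Complex.continuous_im.continuousAt.comp ?_).continuousWithinAt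
    have hNs := (hcone _ (hin s hs.1).1 (hin s hs.1).2).1
    exact ContinuousAt.comp (f := fun s : ℝ => z + s * R z) (g := fun w => (u - w) / R w)
      (h.continuousAt_div u hNs) (by fun_prop)
  obtain ⟨s, hs, hs0⟩ := intermediate_value_Icc' hs12 hcont ⟨hend.le, hstart.le⟩
  obtain ⟨hc1, hc2⟩ := hin s hs.1
  obtain ⟨hNs, hres, -⟩ := hcone _ hc1 hc2
  have hsq := sq_le_sq' (by linarith [abs_nonneg (z + s * R z).im]) hc2
  rw [sq_abs] at hsq
  have := (abs_le.mp hres).1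
  refine hzS (hS.2.2 z hzN s (hs₁.trans hs.1) (h.mem_of_div_eq hS hu hNs hs0 ?_))
  nlinarith [sq_nonneg (z + s * R z).re]

theorem im_le_of_re_pos (h : IsNormalizedField N R) (hS : IsRayInvariant N R S) {β : ℝ}
    (hβ : ∀ w ∈ S, w.im ≤ β) {z : ℂ} (hz : z ∈ horizontalSet N R) (hpos : 0 < (R z).re) :
    z.im ≤ β := by
  by_contra! hlt
  obtain ⟨u, hu⟩ := h.nonempty
  obtain ⟨ρ, hρ⟩ := h.not_ray_downwards hS hβ (hS.2.1 hu)
  -- At this parameter the horizontal ray from `z` has real part above `ρ` and above `2 * z.im`.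
  -- These strict inequalities survive a small perturbation of `z`.
  set s₁ := (|ρ| + |z.re| + 2 * |z.im| + 1) / (R z).re
  have hs₁ : 0 ≤ s₁ := by positivity
  have hsR : s₁ * (R z).re = |ρ| + |z.re| + 2 * |z.im| + 1 := div_mul_cancel₀ _ hpos.ne'
  have hcR := h.continuousAt z hz.1
  have hcre : ContinuousAt (fun w => (R w).re) z := Complex.continuous_re.continuousAt.comp hcR
  have hcim : ContinuousAt (fun w => (R w).im) z := Complex.continuous_im.continuousAt.comp hcR
  have hcw : ContinuousAt (fun w => w + s₁ * R w) z := by fun_prop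
  have hwre : ContinuousAt (fun w => (w + s₁ * R w).re) z :=
    Complex.continuous_re.continuousAt.comp hcw
  have hwim : ContinuousAt (fun w => (w + s₁ * R w).im) z :=
    Complex.continuous_im.continuousAt.comp hcw
  have h0re : (z + s₁ * R z).re = z.re + s₁ * (R z).re := by
    rw [Complex.add_re, Complex.re_ofReal_mul]
  have h0im : (z + s₁ * R z).im = z.im := by
    rw [Complex.add_im, Complex.im_ofReal_mul, hz.2, mul_zero, add_zero]
  have e1 : ∀ᶠ w in 𝓝 z, β < w.im :=
    continuousAt_const.eventually_lt Complex.continuous_im.continuousAt hlt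
  have e2 : ∀ᶠ w in 𝓝 z, -(R w).im < (R w).re / 2 :=
    hcim.neg.eventually_lt (hcre.div_const 2) (by
      simp only [Pi.neg_apply, hz.2]; linarith)
  have e3 : ∀ᶠ w in 𝓝 z, ρ < (w + s₁ * R w).re :=
    continuousAt_const.eventually_lt hwre (by
      rw [h0re]; linarith [le_abs_self ρ, neg_abs_le z.re, abs_nonneg z.im])
  have e4 : ∀ᶠ w in 𝓝 z, β < (w + s₁ * R w).im :=
    continuousAt_const.eventually_lt hwim (by rwa [h0im])
  have e5 : ∀ᶠ w in 𝓝 z, (w + s₁ * R w).im < (w + s₁ * R w).re / 2 :=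
    hwim.eventually_lt (hwre.div_const 2) (by
      rw [h0im, h0re]; linarith [abs_nonneg ρ, neg_abs_le z.re, le_abs_self z.im])
  obtain ⟨w, hw, w1, w2, w3, w4, w5⟩ :=
    ((h.frequently_im_neg hz).and_eventually (e1.and (e2.and (e3.and (e4.and e5))))).exists
  exact hρ w w1 hw w2.le s₁ hs₁ w3 w4 w5

/-- Complex conjugation turns a normalized field into a normalized field. -/
theorem conj (h : IsNormalizedField N R) : IsNormalizedField (Complex.conjLIE ⁻¹' N)
    (fun z => Complex.conjLIE.symm (R (Complex.conjLIE z))) :=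
  h.symmetry Complex.conjLIE fun z => by simp

/-- The half turn turns a normalized field into a normalized field. -/
theorem neg (h : IsNormalizedField N R) : IsNormalizedField (LinearIsometryEquiv.neg ℝ ⁻¹' N)
    (fun z => (LinearIsometryEquiv.neg ℝ).symm (R (LinearIsometryEquiv.neg ℝ z))) :=
  h.symmetry (LinearIsometryEquiv.neg ℝ) fun z => by simp [inv_neg]

theorem le_im_of_re_pos (h : IsNormalizedField N R) (hS : IsRayInvariant N R S) {α : ℝ}
    (hα : ∀ w ∈ S, α ≤ w.im) {z : ℂ} (hz : z ∈ horizontalSet N R) (hpos : 0 < (R z).re) :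
    α ≤ z.im := by
  have := h.conj.im_le_of_re_pos (hS.preimage Complex.conjLIE.toContinuousLinearEquiv) (β := -α)
    (fun w hw => by simpa using neg_le_neg (hα _ hw)) (z := Complex.conjLIE z)
    ⟨by simpa using hz.1, by simpa using hz.2⟩ (by simpa using hpos)
  simpa using this

theorem im_le_of_mem_horizontalSet (h : IsNormalizedField N R) (hS : IsRayInvariant N R S) {β : ℝ}
    (hβ : ∀ w ∈ S, w.im ≤ β) {z : ℂ} (hz : z ∈ horizontalSet N R) : z.im ≤ β := by
  rcases lt_trichotomy 0 (R z).re with hre | hre | hre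
  · exact h.im_le_of_re_pos hS hβ hz hre
  · exact absurd (Complex.ext hre.symm hz.2) (h.ne_zero z hz.1)
  · have := h.neg.le_im_of_re_pos (hS.preimage (LinearIsometryEquiv.neg ℝ).toContinuousLinearEquiv)
      (α := -β) (fun w hw => by have := hβ _ hw; simp at this; linarith) (z := -z)
      ⟨by simpa using hz.1, by simpa using hz.2⟩ (by simpa using hre)
    simpa using this

theorem le_im_of_mem_horizontalSet (h : IsNormalizedField N R) (hS : IsRayInvariant N R S) {α : ℝ}
    (hα : ∀ w ∈ S, α ≤ w.im) {z : ℂ} (hz : z ∈ horizontalSet N R) : α ≤ z.im := by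
  have := h.conj.im_le_of_mem_horizontalSet
    (hS.preimage Complex.conjLIE.toContinuousLinearEquiv) (β := -α)
    (fun w hw => by simpa using neg_le_neg (hα _ hw)) (z := Complex.conjLIE z)
    ⟨by simpa using hz.1, by simpa using hz.2⟩
  simpa using this

/-! ### Extreme heights, strips and convex hulls. -/

theorem exists_mem_re_le (h : IsNormalizedField N R) (hS : IsRayInvariant N R S) (X : ℝ) :
    ∃ w ∈ S, w.re ≤ X := by
  obtain ⟨w, hw, hX⟩ := h.neg.exists_mem_re_ge
    (hS.preimage (LinearIsometryEquiv.neg ℝ).toContinuousLinearEquiv) (-X)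
  exact ⟨-w, by simpa using hw, by simpa using neg_le_neg hX⟩

theorem exists_le_im (h : IsNormalizedField N R) :
    ∃ Y, ∀ z ∈ N ∪ horizontalSet N R, z.im ≤ Y := by
  obtain ⟨Y, hY⟩ := h.exists_im_pos
  refine ⟨Y, fun z hz => ?_⟩
  by_contra! hlt
  obtain ⟨h1, h2⟩ := hY z hlt
  exact hz.elim h1 fun hz => h2.ne' hz.2

theorem exists_im_ge (h : IsNormalizedField N R) :
    ∃ Y, ∀ z ∈ N ∪ horizontalSet N R, Y ≤ z.im := by
  obtain ⟨Y, hY⟩ := h.conj.exists_le_im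
  refine ⟨-Y, fun z hz => ?_⟩
  have := hY (Complex.conjLIE z) (hz.imp (fun hz => by simpa using hz)
    fun hz => ⟨by simpa using hz.1, by simpa using hz.2⟩)
  simp at this
  linarith

theorem im_neg_below (h : IsNormalizedField N R) {a : ℝ}
    (ha : ∀ z ∈ N ∪ horizontalSet N R, a ≤ z.im) {z : ℂ} (hz : z.im < a) : (R z).im < 0 := by
  have := h.conj.im_pos_above (b := -a) (fun w hw => by
    have := ha (Complex.conjLIE w) (hw.imp (fun hw => by simpa using hw)
      fun hw => ⟨by simpa using hw.1, by simpa using hw.2⟩)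
    simp at this
    linarith) (z := Complex.conjLIE z) (by simpa using hz)
  simpa using this

/-- A horizontal strip containing the exceptional set and all horizontal points is invariant. -/
theorem isRayInvariant_strip (h : IsNormalizedField N R) {a b : ℝ}
    (ha : ∀ z ∈ N ∪ horizontalSet N R, a ≤ z.im) (hb : ∀ z ∈ N ∪ horizontalSet N R, z.im ≤ b) :
    IsRayInvariant N R {z | a ≤ z.im ∧ z.im ≤ b} := by
  refine ⟨?_, fun z hz => ⟨ha z (Or.inl hz), hb z (Or.inl hz)⟩, fun z hz t ht hm => ?_⟩
  · exact (isClosed_le continuous_const Complex.continuous_im).inter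
      (isClosed_le Complex.continuous_im continuous_const)
  · simp only [mem_ofPred_eq, Complex.add_im, Complex.im_ofReal_mul] at hm ⊢
    -- Outside the strip the field points away from it, so a forward ray cannot come back.
    constructor
    · by_contra! hlt
      nlinarith [h.im_neg_below ha hlt]
    · by_contra! hlt
      nlinarith [h.im_pos_above hb hlt]

/-- The closed convex hull of an invariant set of bounded height contains every point lying between
the extreme heights of the exceptional set and the horizontal points. -/
theorem mem_closure_convexHull (h : IsNormalizedField N R) (hS : IsRayInvariant N R S) {a b : ℝ}
    (ha : ∀ w ∈ S, a ≤ w.im) (hb : ∀ w ∈ S, w.im ≤ b) {z : ℂ}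
    (hlo : ∀ α, (∀ w ∈ N ∪ horizontalSet N R, α ≤ w.im) → α ≤ z.im)
    (hhi : ∀ β, (∀ w ∈ N ∪ horizontalSet N R, w.im ≤ β) → z.im ≤ β) :
    z ∈ closure (convexHull ℝ S) := by
  by_contra hz
  obtain ⟨f, s, hfz, hf⟩ := geometric_hahn_banach_point_closed
    (convex_convexHull ℝ S).closure isClosed_closure hz
  have hfS : ∀ w ∈ S, s < f w := fun w hw => hf w (subset_closure (subset_convexHull ℝ S hw))
  have hform : ∀ w : ℂ, f w = w.re * f 1 + w.im * f Complex.I := fun w => by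
    have hw : w = w.re • (1 : ℂ) + w.im • Complex.I := by
      apply Complex.ext <;> simp
    conv_lhs => rw [hw]
    rw [map_add, map_smul, map_smul, smul_eq_mul, smul_eq_mul]
  set p := f 1
  set q := f Complex.I
  obtain ⟨C, hC⟩ : ∃ C, ∀ w ∈ S, w.im * q ≤ C := by
    refine ⟨max (a * q) (b * q), fun w hw => ?_⟩
    rcases le_total 0 q with hq | hq
    · exact (mul_le_mul_of_nonneg_right (hb w hw) hq).trans (le_max_right _ _)
    · exact (mul_le_mul_of_nonpos_right (ha w hw) hq).trans (le_max_left _ _)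
  -- `S` is unbounded in both horizontal directions at bounded height, so a functional bounded below
  -- on it ignores the real part.
  have hp : p = 0 := by
    rcases lt_trichotomy p 0 with hp | hp | hp
    · obtain ⟨w, hw, hX⟩ := h.exists_mem_re_ge hS ((s - C) / p)
      rw [div_le_iff_of_neg hp] at hX
      linarith [hC w hw, hform w, hfS w hw]
    · exact hp
    · obtain ⟨w, hw, hX⟩ := h.exists_mem_re_le hS ((s - C) / p)
      rw [le_div_iff₀ hp] at hX
      linarith [hC w hw, hform w, hfS w hw]
  have hform' : ∀ w : ℂ, f w = w.im * q := fun w => by rw [hform, hp]; ring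
  rw [hform'] at hfz
  -- Separation is now a height bound on `S`. It passes to `N` and the horizontal points, hence to
  -- `z`.
  rcases lt_trichotomy q 0 with hq | hq | hq
  · have hβ : ∀ w ∈ S, w.im ≤ s / q := fun w hw => by
      rw [le_div_iff_of_neg hq, ← hform']
      exact (hfS w hw).le
    have := hhi (s / q) fun w hw => hw.elim (fun hw => hβ w (hS.2.1 hw))
      fun hw => h.im_le_of_mem_horizontalSet hS hβ hw
    rw [le_div_iff_of_neg hq] at this
    linarith
  · obtain ⟨w, hw⟩ := h.nonempty
    have := hfS w (hS.2.1 hw)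
    rw [hform', hq, mul_zero] at this
    rw [hq, mul_zero] at hfz
    linarith
  · have hα : ∀ w ∈ S, s / q ≤ w.im := fun w hw => by
      rw [div_le_iff₀ hq, ← hform']
      exact (hfS w hw).le
    have := hlo (s / q) fun w hw => hw.elim (fun hw => hα w (hS.2.1 hw))
      fun hw => h.le_im_of_mem_horizontalSet hS hα hw
    rw [div_le_iff₀ hq] at this
    linarith

/-- Any strip containing the horizontal points is horizontal, hence contains every point lying
between the extreme heights. -/
theorem mem_closedStrip (h : IsNormalizedField N R) {v : ℂ} {a b : ℝ} (hv : v ≠ 0)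
    (hsub : N ∪ horizontalSet N R ⊆ closedStrip v a b) {z : ℂ}
    (hlo : ∀ α, (∀ w ∈ N ∪ horizontalSet N R, α ≤ w.im) → α ≤ z.im)
    (hhi : ∀ β, (∀ w ∈ N ∪ horizontalSet N R, w.im ≤ β) → z.im ≤ β) :
    z ∈ closedStrip v a b := by
  obtain ⟨Y₁, hY₁⟩ := h.exists_im_ge
  obtain ⟨Y₂, hY₂⟩ := h.exists_le_im
  have hform : ∀ w : ℂ, (w / v).im = w.re * (v⁻¹).im + w.im * (v⁻¹).re := fun w => by
    rw [div_eq_mul_inv, Complex.mul_im]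
  have hstrip : ∀ w, w ∈ closedStrip v a b ↔ a ≤ (w / v).im ∧ (w / v).im ≤ b := fun w => Iff.rfl
  simp only [hform] at hstrip
  have hvne : v⁻¹ ≠ 0 := inv_ne_zero hv
  set p := (v⁻¹).im with hp_def
  set q := (v⁻¹).re with hq_def
  have hbd : ∀ w ∈ N ∪ horizontalSet N R, |w.im * q| ≤ max |Y₁| |Y₂| * |q| := fun w hw => by
    rw [abs_mul]
    gcongr
    exact abs_le_max_abs_abs (hY₁ w hw) (hY₂ w hw)
  -- Horizontal points have bounded height and arbitrarily large real part, which a tilted strip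
  -- cannot contain.
  have hp : p = 0 := by
    rcases lt_trichotomy p 0 with hp | hp | hp
    · obtain ⟨w, hw, hX⟩ := h.exists_horizontal_re_ge ((a - max |Y₁| |Y₂| * |q| - 1) / p)
      rw [div_le_iff_of_neg hp] at hX
      have h1 := ((hstrip w).mp (hsub (Or.inr hw))).1
      linarith [(abs_le.mp (hbd w (Or.inr hw))).2]
    · exact hp
    · obtain ⟨w, hw, hX⟩ := h.exists_horizontal_re_ge ((b + max |Y₁| |Y₂| * |q| + 1) / p)
      rw [div_le_iff₀ hp] at hX
      have h1 := ((hstrip w).mp (hsub (Or.inr hw))).2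
      linarith [(abs_le.mp (hbd w (Or.inr hw))).1]
  have hq : q ≠ 0 := fun hq => hvne (Complex.ext hq hp)
  simp only [hp, mul_zero, zero_add] at hstrip
  rw [hstrip]
  rcases hq.lt_or_gt with hq | hq
  · refine ⟨(le_div_iff_of_neg hq).mp (hhi _ fun w hw => ?_),
      (div_le_iff_of_neg hq).mp (hlo _ fun w hw => ?_)⟩
    · exact (le_div_iff_of_neg hq).mpr ((hstrip w).mp (hsub hw)).1
    · exact (div_le_iff_of_neg hq).mpr ((hstrip w).mp (hsub hw)).2
  · refine ⟨(div_le_iff₀ hq).mp (hlo _ fun w hw => ?_),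
      (le_div_iff₀ hq).mp (hhi _ fun w hw => ?_)⟩
    · exact (div_le_iff₀ hq).mpr ((hstrip w).mp (hsub hw)).1
    · exact (le_div_iff₀ hq).mpr ((hstrip w).mp (hsub hw)).2

/-- The closed convex hull of the least invariant set is the least strip containing the exceptional
set and the horizontal points, and it is invariant. -/
theorem closure_convexHull_eq_strip (h : IsNormalizedField N R) {M : Set ℂ}
    (hM : IsRayInvariant N R M) (hmin : ∀ S, IsRayInvariant N R S → M ⊆ S) :
    ∃ a b : ℝ, a ≤ b ∧ closure (convexHull ℝ M) = closedStrip 1 a b ∧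
      IsRayInvariant N R (closedStrip 1 a b) ∧
      N ∪ horizontalSet N R ⊆ closedStrip 1 a b ∧
      ∀ v : ℂ, ∀ a' b' : ℝ, v ≠ 0 → N ∪ horizontalSet N R ⊆ closedStrip v a' b' →
        closedStrip 1 a b ⊆ closedStrip v a' b' := by
  obtain ⟨Y₁, hY₁⟩ := h.exists_im_ge
  obtain ⟨Y₂, hY₂⟩ := h.exists_le_im
  set T := Complex.im '' (N ∪ horizontalSet N R)
  obtain ⟨w₀, hw₀⟩ := h.nonempty
  have hT : T.Nonempty := ⟨_, mem_image_of_mem _ (Or.inl hw₀)⟩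
  have hTb : BddBelow T := ⟨Y₁, forall_mem_image.mpr hY₁⟩
  have hTa : BddAbove T := ⟨Y₂, forall_mem_image.mpr hY₂⟩
  have ha : ∀ z ∈ N ∪ horizontalSet N R, sInf T ≤ z.im := fun z hz =>
    csInf_le hTb (mem_image_of_mem _ hz)
  have hb : ∀ z ∈ N ∪ horizontalSet N R, z.im ≤ sSup T := fun z hz =>
    le_csSup hTa (mem_image_of_mem _ hz)
  have hK : closedStrip 1 (sInf T) (sSup T) = {z | sInf T ≤ z.im ∧ z.im ≤ sSup T} := by
    simp [closedStrip]
  have hinv := h.isRayInvariant_strip ha hb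
  have hlo : ∀ z ∈ closedStrip 1 (sInf T) (sSup T),
      ∀ α, (∀ w ∈ N ∪ horizontalSet N R, α ≤ w.im) → α ≤ z.im := fun z hz α hα => by
    rw [hK] at hz
    exact (le_csInf hT (forall_mem_image.mpr hα)).trans hz.1
  have hhi : ∀ z ∈ closedStrip 1 (sInf T) (sSup T),
      ∀ β, (∀ w ∈ N ∪ horizontalSet N R, w.im ≤ β) → z.im ≤ β := fun z hz β hβ => by
    rw [hK] at hz
    exact hz.2.trans (csSup_le hT (forall_mem_image.mpr hβ))
  have hMK := hmin _ hinv
  refine ⟨sInf T, sSup T, csInf_le_csSup hT hTb hTa, ?_, hK ▸ hinv, ?_, ?_⟩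
  · refine Subset.antisymm ?_ fun z hz => h.mem_closure_convexHull hM (fun w hw => (hMK hw).1)
      (fun w hw => (hMK hw).2) (hlo z hz) (hhi z hz)
    rw [hK]
    refine closure_minimal (convexHull_min hMK ?_) hinv.1
    exact (convex_halfSpace_im_ge _).inter (convex_halfSpace_im_le _)
  · exact fun z hz => hK ▸ ⟨ha z hz, hb z hz⟩
  · exact fun v a' b' hv hsub z hz => h.mem_closedStrip hv hsub (hlo z hz) (hhi z hz)

end IsNormalizedField

/-! ### From the differential operator to the ray condition. -/

variable {P Q : ℂ[X]}

theorem deriv_of_exp_eq {u z : ℂ} {L : ℂ → ℂ} (hL : AnalyticAt ℂ L z)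
    (he : ∀ᶠ w in 𝓝 z, Complex.exp (L w) = w - u) : deriv L z = (z - u)⁻¹ := by
  have h1 : HasDerivAt (fun w => Complex.exp (L w)) (Complex.exp (L z) * deriv L z) z :=
    hL.differentiableAt.hasDerivAt.cexp
  have h2 : HasDerivAt (fun w => Complex.exp (L w)) 1 z :=
    ((hasDerivAt_id z).sub_const u).congr_of_eventuallyEq he
  have h3 := h1.unique h2
  rw [he.self_of_nhds] at h3
  exact eq_inv_of_mul_eq_one_right h3

theorem diffOp_exp_log {u z : ℂ} {t : ℝ} {L f : ℂ → ℂ} (hL : AnalyticAt ℂ L z)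
    (he : ∀ᶠ w in 𝓝 z, Complex.exp (L w) = w - u)
    (hf : f =ᶠ[𝓝 z] fun w => Complex.exp ((t : ℂ) * L w)) :
    diffOp P Q f z = Complex.exp (t * L z) * (Q.eval z * (t * (z - u)⁻¹) + P.eval z) := by
  have h1 : HasDerivAt f (Complex.exp (t * L z) * (t * deriv L z)) z :=
    ((hL.differentiableAt.hasDerivAt.const_mul (t : ℂ)).cexp).congr_of_eventuallyEq hf
  rw [diffOp, h1.deriv, hf.self_of_nhds, deriv_of_exp_eq hL he]
  ring

/-- A branch of `(z - u)^t` is an exponential, so it never vanishes and can be cancelled from `T`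
applied to it. -/
theorem isImageRoot_iff {u z : ℂ} {t : ℝ} :
    IsImageRoot P Q u t z ↔ z ≠ u ∧ t * Q.eval z + (z - u) * P.eval z = 0 := by
  constructor
  · rintro ⟨f, ⟨L, hL, he, hf⟩, h0⟩
    have hz : z - u ≠ 0 := by
      rw [← he.self_of_nhds]; exact Complex.exp_ne_zero _
    rw [diffOp_exp_log hL he hf] at h0
    have h1 := (mul_eq_zero.mp h0).resolve_left (Complex.exp_ne_zero _)
    refine ⟨sub_ne_zero.mp hz, ?_⟩
    field_simp at h1
    linear_combination h1
  · rintro ⟨hz, h0⟩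
    have hz : z - u ≠ 0 := sub_ne_zero.mpr hz
    -- Dividing by `z - u` makes the argument of the logarithm equal to 1 at `z`, off the branch
    -- cut.
    set L : ℂ → ℂ := fun w => Complex.log ((w - u) / (z - u)) + Complex.log (z - u)
    have hL : AnalyticAt ℂ L z := by
      refine AnalyticAt.add (AnalyticAt.clog (by fun_prop (disch := exact hz)) ?_) analyticAt_const
      rw [div_self hz]
      exact Complex.one_mem_slitPlane
    have he : ∀ᶠ w in 𝓝 z, Complex.exp (L w) = w - u := by
      filter_upwards [(continuousAt_id.sub continuousAt_const).eventually_ne hz] with w hw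
      have hw : w - u ≠ 0 := hw
      rw [Complex.exp_add, Complex.exp_log (div_ne_zero hw hz), Complex.exp_log hz,
        div_mul_cancel₀ _ hz]
    refine ⟨_, ⟨L, hL, he, EventuallyEq.rfl⟩, ?_⟩
    rw [diffOp_exp_log hL he EventuallyEq.rfl]
    have : Q.eval z * (t * (z - u)⁻¹) + P.eval z = 0 := by
      field_simp
      linear_combination h0
    rw [this, mul_zero]

/-- A nonconstant quotient of polynomials satisfies the open mapping property. -/
theorem nhds_le_map_div {p q : ℂ[X]} (hne : ∀ c : ℂ, q - C c * p ≠ 0) {z : ℂ}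
    (hz : p.eval z ≠ 0) :
    𝓝 (q.eval z / p.eval z) ≤ map (fun w => q.eval w / p.eval w) (𝓝 z) := by
  have han : AnalyticAt ℂ (fun w => q.eval w / p.eval w) z :=
    (AnalyticOnNhd.eval_polynomial q z (mem_univ z)).div
      (AnalyticOnNhd.eval_polynomial p z (mem_univ z)) hz
  refine han.eventually_constant_or_nhds_le_map_nhds.resolve_left fun hconst => ?_
  refine hne (q.eval z / p.eval z) (Polynomial.eq_zero_of_infinite_isRoot _ ?_)
  have hev : ∀ᶠ w in 𝓝 z, (q - C (q.eval z / p.eval z) * p).IsRoot w := by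
    filter_upwards [hconst, p.continuous.continuousAt.eventually_ne hz] with w hw hpw
    rw [IsRoot.def, eval_sub, eval_mul, eval_C, ← hw, div_mul_cancel₀ _ hpw, sub_self]
  exact infinite_of_mem_nhds z hev

theorem exists_isRoot (hdeg : P.natDegree = Q.natDegree + 1) : ∃ z, P.eval z = 0 :=
  IsAlgClosed.exists_root P fun h => by
    have := natDegree_eq_zero_iff_degree_le_zero.mpr h.le
    lia

theorem sub_C_mul_ne_zero (hQ : Q ≠ 0) (hdeg : P.natDegree = Q.natDegree + 1) (c : ℂ) :
    Q - C c * P ≠ 0 := by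
  intro h
  by_cases hc : c = 0
  · simp [hc] at h
    exact hQ h
  · have := congrArg natDegree (sub_eq_zero.mp h)
    rw [natDegree_C_mul hc] at this
    lia

/-- The value `t = 0` forces the roots of `P` into `S`, and letting `t → ∞` forces the roots of `Q`.
The other roots are governed by `u = z + t R(z)`. -/
theorem isCHInvariant_iff (hP : P ≠ 0) (hQ : Q ≠ 0) (hdeg : P.natDegree = Q.natDegree + 1)
    {S : Set ℂ} : S.Nonempty ∧ IsCHInvariant P Q S ↔
      IsRayInvariant (rootLocus P Q) (fun z => Q.eval z / P.eval z) S := by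
  constructor
  · rintro ⟨⟨u, hu⟩, hclosed, hinv⟩
    have hmem : ∀ u ∈ S, ∀ t : ℝ, 0 ≤ t → ∀ z, t * Q.eval z + (z - u) * P.eval z = 0 → z ∈ S := by
      intro u hu t ht z hz
      by_cases hzu : z = u
      · rwa [hzu]
      refine ((hinv u hu t ht).resolve_right fun hall => ?_) z (isImageRoot_iff.mpr ⟨hzu, hz⟩)
      -- Identical vanishing is impossible: `(X - u)P` has degree `deg Q + 2`.
      have h0 : C (t : ℂ) * Q + (X - C u) * P = 0 := by
        refine Polynomial.eq_zero_of_infinite_isRoot _ ?_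
        refine (Set.finite_singleton u).infinite_compl.mono fun w hw => ?_
        simpa [IsRoot.def] using (isImageRoot_iff.mp (hall w hw)).2
      have h1 := congrArg natDegree (eq_neg_of_add_eq_zero_right h0)
      rw [natDegree_neg, natDegree_mul (X_sub_C_ne_zero u) hP, natDegree_X_sub_C] at h1
      have := natDegree_C_mul_le (t : ℂ) Q
      lia
    have hPS : ∀ z, P.eval z = 0 → z ∈ S := fun z hz =>
      hmem u hu 0 le_rfl z (by simp [hz])
    -- Near a root of `Q` outside `S`, the open map `Q / ((u - w) P)` takes the values `1/(n + 1)`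
    -- for large `n`, giving roots for `t = n + 1` outside the closed set `S`.
    have hQS : ∀ z, Q.eval z = 0 → z ∈ S := by
      intro z hz
      by_contra hzS
      have hPz : P.eval z ≠ 0 := fun h => hzS (hPS z h)
      have hzu : u - z ≠ 0 := sub_ne_zero.mpr fun h => hzS (h ▸ hu)
      have hev : (((C u - X) * P).eval z) ≠ 0 := by simp [hPz, hzu]
      have hopen := nhds_le_map_div (p := (C u - X) * P) (q := Q) (fun c hc => ?_) hev
      · rw [hz, zero_div] at hopen
        have hV := hopen (image_mem_map (hclosed.isOpen_compl.mem_nhds hzS))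
        have htend : Tendsto (fun n : ℕ => ((1 / ((n : ℝ) + 1) : ℝ) : ℂ)) atTop (𝓝 0) := by
          exact_mod_cast (Complex.continuous_ofReal.tendsto 0).comp
            tendsto_one_div_add_atTop_nhds_zero_nat
        obtain ⟨n, w, hw, hwn⟩ := (htend.eventually hV).exists
        refine hw (hmem u hu ((n : ℝ) + 1) (by positivity) w ?_)
        simp only [eval_mul, eval_sub, eval_C, eval_X] at hwn
        have hd : (u - w) * P.eval w ≠ 0 := by
          intro hd
          rw [hd, div_zero] at hwn
          have : (1 / ((n : ℝ) + 1) : ℝ) ≠ 0 := by positivity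
          exact this (by exact_mod_cast hwn.symm)
        have hn : ((n : ℂ) + 1) ≠ 0 := by exact_mod_cast n.succ_ne_zero
        push_cast at hwn ⊢
        rw [div_eq_div_iff hd hn] at hwn
        linear_combination hwn
      · by_cases hc0 : c = 0
        · simp [hc0] at hc
          exact hQ hc
        · have h1 := congrArg natDegree (sub_eq_zero.mp hc)
          have hne : (C u - X : ℂ[X]) ≠ 0 := by
            rw [← neg_sub]; exact neg_ne_zero.mpr (X_sub_C_ne_zero u)
          rw [natDegree_C_mul hc0, natDegree_mul hne hP, ← neg_sub, natDegree_neg,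
            natDegree_X_sub_C] at h1
          lia
    refine ⟨hclosed, fun z hz => hz.elim (hPS z) (hQS z), fun z hz t ht hm => ?_⟩
    have hPz : P.eval z ≠ 0 := fun h => hz (Or.inl h)
    refine hmem _ hm t ht z ?_
    field_simp
    ring
  · rintro ⟨hclosed, hN, hray⟩
    obtain ⟨z₀, hz₀⟩ := exists_isRoot hdeg
    refine ⟨⟨z₀, hN (Or.inl hz₀)⟩, hclosed, fun u hu t ht => Or.inl fun z hz => ?_⟩
    by_cases hzN : z ∈ rootLocus P Q
    · exact hN hzN
    have hPz : P.eval z ≠ 0 := fun h => hzN (Or.inl h)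
    refine hray z hzN t ht ?_
    have : z + t * (Q.eval z / P.eval z) = u := by
      have := (isImageRoot_iff.mp hz).2
      field_simp
      linear_combination this
    rwa [this]

theorem isRayInvariant_minimalCHSet (hP : P ≠ 0) (hQ : Q ≠ 0)
    (hdeg : P.natDegree = Q.natDegree + 1) :
    IsRayInvariant (rootLocus P Q) (fun z => Q.eval z / P.eval z) (minimalCHSet P Q) :=
  isRayInvariant_sInter fun _ hS => (isCHInvariant_iff hP hQ hdeg).mp hS

theorem minimalCHSet_subset (hP : P ≠ 0) (hQ : Q ≠ 0) (hdeg : P.natDegree = Q.natDegree + 1)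
    {S : Set ℂ} (hS : IsRayInvariant (rootLocus P Q) (fun z => Q.eval z / P.eval z) S) :
    minimalCHSet P Q ⊆ S :=
  sInter_subset_of_mem ((isCHInvariant_iff hP hQ hdeg).mpr hS)

/-! ### The rotated field and its horizontal locus. -/

/-- The behaviour of `P / Q` at infinity. -/
theorem exists_tendsto_div_add (hP : P ≠ 0) (hQ : Q ≠ 0) (hdeg : P.natDegree = Q.natDegree + 1)
    {v : ℂ} (hv : v ^ 2 = -leadRatio P Q) :
    ∃ c, Tendsto (fun z => v * (P.eval z / Q.eval z) + z / v) (cobounded ℂ) (𝓝 c) := by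
  have hlead : leadRatio P Q ≠ 0 :=
    div_ne_zero (leadingCoeff_ne_zero.mpr hQ) (leadingCoeff_ne_zero.mpr hP)
  have hv0 : v ≠ 0 := by
    rintro rfl
    exact hlead (by simpa using hv)
  have hdle : Q.degree ≤ P.degree := by
    rw [degree_eq_natDegree hQ, degree_eq_natDegree hP, hdeg]
    exact_mod_cast Nat.le_succ _
  have hA1 : (P / Q).natDegree = 1 := by
    have h2 := degree_add_div hQ hdle
    have h3 : P / Q ≠ 0 := fun h0 => by simp [h0, degree_eq_natDegree hP] at h2
    rw [degree_eq_natDegree hQ, degree_eq_natDegree h3, degree_eq_natDegree hP] at h2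
    norm_cast at h2
    lia
  have hA2 : (P / Q).coeff 1 = (leadRatio P Q)⁻¹ := by
    rw [← hA1, coeff_natDegree, leadingCoeff_div hdle, leadRatio, inv_div]
  have hA : ∀ z, (P / Q).eval z = (leadRatio P Q)⁻¹ * z + (P / Q).coeff 0 := fun z => by
    conv_lhs => rw [eq_X_add_C_of_natDegree_le_one hA1.le]
    simp [hA2]
  have hB : Tendsto (fun z => (P % Q).eval z / Q.eval z) (cobounded ℂ) (𝓝 0) :=
    (isLittleO_cobounded_of_degree_lt (degree_mod_lt P hQ)).tendsto_div_nhds_zero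
  -- The linear term of `v * (P / Q)` is `v z / λ = -z / v`, which cancels `z / v` and leaves the
  -- constant term.
  refine ⟨v * (P / Q).coeff 0, ?_⟩
  have hlim := (tendsto_const_nhds (x := v * (P / Q).coeff 0)).add (hB.const_mul v)
  rw [mul_zero, add_zero] at hlim
  refine hlim.congr' ?_
  have hroots : ∀ᶠ z in cobounded ℂ, Q.eval z ≠ 0 := by
    have : IsBounded {z | Q.eval z = 0} := by
      refine (Q.rootSet_finite ℂ).isBounded.subset fun z hz => ?_
      rw [mem_rootSet]
      exact ⟨hQ, by simpa using hz⟩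
    exact isBounded_def.mp this
  filter_upwards [hroots] with z hz
  have hdiv : P.eval z = Q.eval z * (P / Q).eval z + (P % Q).eval z := by
    rw [← eval_mul, ← eval_add, EuclideanDomain.div_add_mod]
  have hl : (leadRatio P Q)⁻¹ = -(v ^ 2)⁻¹ := by rw [hv, inv_neg, neg_neg]
  rw [hdiv, hA, hl]
  field_simp
  ring

/-- The direction of the horizontal locus, normalized to a square root of `-λ`. -/
def stripDirection (P Q : ℂ[X]) : ℂ :=
  (√‖leadRatio P Q‖ : ℝ) * Complex.exp ((((leadRatio P Q).arg + Real.pi) / 2 : ℝ) * Complex.I)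

theorem stripDirection_sq : stripDirection P Q ^ 2 = -leadRatio P Q := by
  rw [stripDirection, mul_pow, ← Complex.exp_nat_mul, ← Complex.ofReal_pow,
    Real.sq_sqrt (norm_nonneg _)]
  have : ((2 : ℕ) : ℂ) * ((((leadRatio P Q).arg + Real.pi) / 2 : ℝ) * Complex.I) =
      (leadRatio P Q).arg * Complex.I + Real.pi * Complex.I := by
    push_cast; ring
  rw [this, Complex.exp_add, Complex.exp_pi_mul_I, ← mul_assoc, Complex.norm_mul_exp_arg_mul_I]
  ring

theorem stripDirection_ne_zero (hP : P ≠ 0) (hQ : Q ≠ 0) : stripDirection P Q ≠ 0 := by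
  intro h
  have := stripDirection_sq (P := P) (Q := Q)
  rw [h, zero_pow two_ne_zero, eq_comm, neg_eq_zero] at this
  exact div_ne_zero (leadingCoeff_ne_zero.mpr hQ) (leadingCoeff_ne_zero.mpr hP) this

/-- The two angles are opposite, so both say that the sine of `arg w - θ` vanishes. -/
theorem arg_eq_or_iff_div_im_eq_zero {r θ : ℝ} (hr : r ≠ 0) {w : ℂ} (hw : w ≠ 0) :
    ((w.arg : Real.Angle) = (θ : ℝ) ∨ (w.arg : Real.Angle) = ((θ - Real.pi : ℝ) : Real.Angle)) ↔
      (w / (r * Complex.exp (θ * Complex.I))).im = 0 := by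
  have h1 : w / (r * Complex.exp (θ * Complex.I)) =
      ((‖w‖ / r : ℝ) : ℂ) * Complex.exp ((w.arg - θ : ℝ) * Complex.I) := by
    conv_lhs => rw [← Complex.norm_mul_exp_arg_mul_I w]
    rw [Complex.ofReal_sub, sub_mul, Complex.exp_sub, Complex.ofReal_div]
    field_simp
  rw [h1, Complex.im_ofReal_mul, Complex.exp_ofReal_mul_I_im, mul_eq_zero,
    or_iff_right (div_ne_zero (norm_ne_zero_iff.mpr hw) hr), ← Real.Angle.sin_coe,
    Real.Angle.sin_eq_zero_iff, Real.Angle.coe_sub, Real.Angle.coe_sub, sub_eq_zero, sub_eq_iff_eq_add,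
    Real.Angle.sub_coe_pi_eq_add_coe_pi, add_comm (Real.pi : Real.Angle)]

/-- Multiplication by a nonzero complex number as a real-linear automorphism of the plane. -/
def mulEquiv (v : ℂ) (hv : v ≠ 0) : ℂ ≃L[ℝ] ℂ :=
  ((LinearEquiv.smulOfNeZero ℂ ℂ v hv).restrictScalars ℝ).toContinuousLinearEquiv

theorem mulEquiv_apply {v : ℂ} (hv : v ≠ 0) (z : ℂ) : mulEquiv v hv z = v * z := rfl

theorem mulEquiv_symm_apply {v : ℂ} (hv : v ≠ 0) (z : ℂ) : (mulEquiv v hv).symm z = z / v := by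
  rw [ContinuousLinearEquiv.symm_apply_eq, mulEquiv_apply, mul_div_cancel₀ _ hv]

theorem isBounded_rootLocus (hP : P ≠ 0) (hQ : Q ≠ 0) : IsBounded (rootLocus P Q) := by
  refine (((P * Q).rootSet_finite ℂ).isBounded).subset fun z hz => ?_
  rw [mem_rootSet]
  exact ⟨mul_ne_zero hP hQ, by simpa [rootLocus] using hz⟩

/-- The rotated field is `R(vz)/v ~ λ/(v² z) = -1/z`. -/
theorem isNormalizedField_rotated (hP : P ≠ 0) (hQ : Q ≠ 0) (hdeg : P.natDegree = Q.natDegree + 1)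
    {v : ℂ} (hv : v ≠ 0) (hsq : v ^ 2 = -leadRatio P Q) :
    IsNormalizedField (mulEquiv v hv ⁻¹' rootLocus P Q) (fun z => (mulEquiv v hv).symm
      (Q.eval (mulEquiv v hv z) / P.eval (mulEquiv v hv z))) where
  nonempty := by
    obtain ⟨z, hz⟩ := exists_isRoot hdeg
    exact Nonempty.preimage ⟨z, Or.inl hz⟩ (mulEquiv v hv).surjective
  isBounded := (mulEquiv v hv).antilipschitz.isBounded_preimage (isBounded_rootLocus hP hQ)
  continuousAt z hz := by
    refine (mulEquiv v hv).symm.continuous.continuousAt.comp ?_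
    refine ContinuousAt.div ?_ ?_ fun h => hz (Or.inl h)
    · exact (Q.continuous.comp (mulEquiv v hv).continuous).continuousAt
    · exact (P.continuous.comp (mulEquiv v hv).continuous).continuousAt
  ne_zero z hz := by
    rw [Ne, EmbeddingLike.map_eq_zero_iff]
    exact div_ne_zero (fun h => hz (Or.inr h)) fun h => hz (Or.inl h)
  tendsto := by
    obtain ⟨c, hc⟩ := exists_tendsto_div_add hP hQ hdeg hsq
    refine ⟨c, (hc.comp (mulEquiv v hv).antilipschitz.tendsto_cobounded).congr fun z => ?_⟩
    simp only [Function.comp_apply, mulEquiv_symm_apply]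
    rw [inv_div, div_div_eq_mul_div, mulEquiv_apply, mul_div_cancel_left₀ _ hv, mul_div_assoc]
  nhds_le_map z hz := by
    set φ := mulEquiv v hv
    have h1 := nhds_le_map_div (p := P) (q := Q) (z := φ z) (sub_C_mul_ne_zero hQ hdeg)
      fun h => hz (Or.inl h)
    have e1 : map φ (𝓝 z) = 𝓝 (φ z) := φ.toHomeomorph.map_nhds_eq z
    have e2 : ∀ y, map φ.symm (𝓝 y) = 𝓝 (φ.symm y) := φ.symm.toHomeomorph.map_nhds_eq
    rw [← e2]
    refine (map_mono h1).trans ?_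
    rw [← e1, Filter.map_map, Filter.map_map]
    exact le_rfl

theorem horizontalLocus_eq_closure (hP : P ≠ 0) (hQ : Q ≠ 0) {v : ℂ} (hv : v ≠ 0)
    (hvd : v = stripDirection P Q) :
    horizontalLocus P Q = closure ((mulEquiv v hv).symm ⁻¹'
      horizontalSet (mulEquiv v hv ⁻¹' rootLocus P Q) (fun z => (mulEquiv v hv).symm
        (Q.eval (mulEquiv v hv z) / P.eval (mulEquiv v hv z)))) := by
  have hr : √‖leadRatio P Q‖ ≠ 0 := fun h => stripDirection_ne_zero hP hQ (by
    rw [stripDirection, h, Complex.ofReal_zero, zero_mul])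
  rw [horizontalLocus]
  congr 1
  ext z
  simp only [horizontalSet, mem_preimage, mem_ofPred_eq, ContinuousLinearEquiv.apply_symm_apply]
  refine and_congr_right fun hz => ?_
  have hw : Q.eval z / P.eval z ≠ 0 :=
    div_ne_zero (fun h => hz (Or.inr h)) fun h => hz (Or.inl h)
  have hθ : ((leadRatio P Q).arg - Real.pi) / 2 =
      ((leadRatio P Q).arg + Real.pi) / 2 - Real.pi := by ring
  rw [mulEquiv_symm_apply, hvd, stripDirection, ← arg_eq_or_iff_div_im_eq_zero hr hw, ← hθ,
    fieldDirection]

/-! ### Strips under rotation, and the main theorem. -/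

theorem closedStrip_preimage {v v' : ℂ} (hv : v ≠ 0) (a b : ℝ) :
    mulEquiv v hv ⁻¹' closedStrip v' a b = closedStrip (v' / v) a b := by
  ext z
  simp only [closedStrip, mem_preimage, mem_ofPred_eq, mulEquiv_apply, div_div_eq_mul_div,
    mul_comm v z]

theorem closedStrip_symm_preimage {v : ℂ} (hv : v ≠ 0) (a b : ℝ) :
    (mulEquiv v hv).symm ⁻¹' closedStrip 1 a b = closedStrip v a b := by
  ext z
  simp only [closedStrip, mem_preimage, mem_ofPred_eq, mulEquiv_symm_apply, div_one]

theorem isClosed_closedStrip (v : ℂ) (a b : ℝ) : IsClosed (closedStrip v a b) := by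
  have h : Continuous fun z : ℂ => (z / v).im :=
    Complex.continuous_im.comp (continuous_id.div_const v)
  exact (isClosed_le continuous_const h).inter (isClosed_le h continuous_const)

theorem interior_closedStrip_self {v : ℂ} (hv : v ≠ 0) (a : ℝ) :
    interior (closedStrip v a a) = ∅ := by
  rw [eq_empty_iff_forall_notMem]
  intro z hz
  have hc : Tendsto (fun s : ℝ => z + s * (v * Complex.I)) (𝓝 0) (𝓝 z) := by
    have : Continuous fun s : ℝ => z + s * (v * Complex.I) := by fun_prop
    simpa using this.tendsto 0
  have hev := hc.eventually (mem_interior_iff_mem_nhds.mp hz)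
  obtain ⟨s, hs, hs0⟩ := ((hev.filter_mono nhdsWithin_le_nhds).and
    (self_mem_nhdsWithin (a := (0 : ℝ)) (s := {0}ᶜ))).exists
  have h1 : (z / v).im = a := le_antisymm (interior_subset hz).2 (interior_subset hz).1
  have h2 : ((z + s * (v * Complex.I)) / v).im = a := le_antisymm hs.2 hs.1
  have h3 : (z + s * (v * Complex.I)) / v = z / v + s * Complex.I := by field_simp
  rw [h3, Complex.add_im, h1, Complex.im_ofReal_mul, Complex.I_im, mul_one] at h2
  exact hs0 (by simpa using h2)

theorem ContinuousLinearEquiv.preimage_closure_convexHull (φ : ℂ ≃L[ℝ] ℂ) (M : Set ℂ) :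
    φ ⁻¹' closure (convexHull ℝ M) = closure (convexHull ℝ (φ ⁻¹' M)) := by
  have h1 : convexHull ℝ (φ.symm '' M) = φ.symm '' convexHull ℝ M :=
    ((φ.symm : ℂ →L[ℝ] ℂ).toLinearMap.image_convexHull M).symm
  rw [← φ.image_symm_eq_preimage, ← φ.image_symm_eq_preimage, h1]
  exact φ.symm.toHomeomorph.image_closure _

end

theorem mainTheorem7 (P Q : ℂ[X]) (hP : P ≠ 0) (hQ : Q ≠ 0)
    (hdeg : (Q.natDegree : ℤ) - (P.natDegree : ℤ) = -1) :
    IsLeast {S : Set ℂ | S.Nonempty ∧ Convex ℝ S ∧ IsCHInvariant P Q S} (convMinimalCHSet P Q) ∧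
    IsStrip (convMinimalCHSet P Q) ∧
    ((interior (minimalCHSet P Q)).Nonempty → IsProperStrip (convMinimalCHSet P Q)) ∧
    IsLeast {K : Set ℂ | IsStrip K ∧ horizontalLocus P Q ∪ rootLocus P Q ⊆ K}
      (convMinimalCHSet P Q) := by
  have hdeg : P.natDegree = Q.natDegree + 1 := by lia
  set v := stripDirection P Q with hvd
  have hv : v ≠ 0 := stripDirection_ne_zero hP hQ
  have hmin := isRayInvariant_minimalCHSet hP hQ hdeg
  set φ := mulEquiv v hv with hφ
  have hback : ∀ S, IsRayInvariant (φ ⁻¹' rootLocus P Q)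
      (fun z => φ.symm (Q.eval (φ z) / P.eval (φ z))) S →
      IsRayInvariant (rootLocus P Q) (fun z => Q.eval z / P.eval z) (φ.symm ⁻¹' S) := fun S hS => by
    simpa [← Set.preimage_comp] using hS.preimage φ.symm
  have hfield := isNormalizedField_rotated hP hQ hdeg hv stripDirection_sq
  obtain ⟨a, b, hab, hconv, hinv, hsub, hleast⟩ := hfield.closure_convexHull_eq_strip
    (hmin.preimage φ) (fun S hS z hz => by
      simpa using minimalCHSet_subset hP hQ hdeg (hback S hS) hz)
  have hloc := horizontalLocus_eq_closure hP hQ hv hvd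
  rw [← hφ] at hfield hinv hsub hleast hloc
  set H := horizontalSet (φ ⁻¹' rootLocus P Q) (fun z => φ.symm (Q.eval (φ z) / P.eval (φ z)))
  have hK : convMinimalCHSet P Q = closedStrip v a b := by
    rw [← φ.preimage_closure_convexHull] at hconv
    rw [← closedStrip_symm_preimage hv, ← hconv, ← hφ, ← Set.preimage_comp]
    simp [convMinimalCHSet]
  -- Strips are closed, so the closure in the horizontal locus may be dropped when testing
  -- inclusion.
  have hcontains : ∀ v' a' b', horizontalLocus P Q ∪ rootLocus P Q ⊆ closedStrip v' a' b' ↔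
      φ ⁻¹' rootLocus P Q ∪ H ⊆ φ ⁻¹' closedStrip v' a' b' := fun v' a' b' => by
    rw [Set.union_subset_iff, Set.union_subset_iff, hloc,
      (isClosed_closedStrip v' a' b').closure_subset_iff, and_comm,
      φ.surjective.preimage_subset_preimage_iff]
    refine and_congr_right fun _ => ⟨fun h z hz => h (by simpa using hz), fun h z hz => ?_⟩
    simpa using h hz
  refine ⟨⟨?_, ?_⟩, ?_, ?_, ⟨?_, ?_⟩, ?_⟩
  · have hCH := (isCHInvariant_iff hP hQ hdeg).mpr (hback _ hinv)
    rw [hφ, closedStrip_symm_preimage hv, ← hK] at hCH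
    exact ⟨hCH.1, (convex_convexHull ℝ _).closure, hCH.2⟩
  · rintro S ⟨hne, hconvS, hS⟩
    exact closure_minimal (convexHull_min (Set.sInter_subset_of_mem ⟨hne, hS⟩) hconvS) hS.1
  · exact ⟨v, a, b, hv, hab, hK⟩
  · intro hint
    refine ⟨v, a, b, hv, hab.lt_of_ne fun h => ?_, hK⟩
    -- If the width were zero, `M` would lie in a line, which has empty interior.
    have hsubset : minimalCHSet P Q ⊆ closedStrip v a a := by
      conv_rhs => rw [h]
      rw [h] at hK
      rw [← hK]
      exact (subset_convexHull ℝ _).trans subset_closure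
    have := hint.mono (interior_mono hsubset)
    rw [interior_closedStrip_self hv] at this
    exact Set.not_nonempty_empty this
  · exact ⟨v, a, b, hv, hab, hK⟩
  · rw [hK, hcontains, hφ, closedStrip_preimage, div_self hv]
    exact hsub
  · rintro K ⟨⟨v', a', b', hv', -, rfl⟩, hsubK⟩
    rw [hcontains, hφ, closedStrip_preimage] at hsubK
    have := hleast _ _ _ (div_ne_zero hv' hv) hsubK
    rw [← closedStrip_preimage hv, ← div_self hv, ← closedStrip_preimage hv,
      (mulEquiv v hv).surjective.preimage_subset_preimage_iff] at this
    rwa [hK]
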